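/- Let $d\ge 0$ and let $P\subset\mathbb R^d$ be a simple $d$-polytope, i.e. the convex hull of finitely many points, of dimension $d$, such that every vertex of $P$ lies on exactly $d$ edges. Assume that all edges of $P$ have rational directions (each edge is parallel to a vector of $\mathbb Z^d$; the vertices may be arbitrary real points). For a vertex $v$ of $P$, the edge directions at $v$ are the vectors $w=u-v$, where $[v,u]$ runs over the edges of $P$ containing $v$. For $\xi\in\mathbb R^d$ let $E^+_v(\xi)$ and $E^-_v(\xi)$ be the sets of edge directions $w$ at $v$ with $w\cdot\xi>0$ and with $w\cdot\xi<0$, respectively, and put $$K_{\xi,v}\;=\;v+\sum_{w\in E^+_v(\xi)}\mathbb R_{\ge 0}\,w+\sum_{w\in E^-_v(\xi)}\mathbb R_{<0}\,w .$$ For $A\subseteq\mathbb R^d$ let $S_A=\sum_{m\in A\cap\mathbb Z^d}x^m$, a formal Laurent series in $x_1^{\pm1},\dots,x_d^{\pm1}$. If there are Laurent polynomials $g\ne 0$ and $h$ over $\mathbb C$ with $g\,S_A=h$, then $S_A$ represents the rational function $\sigma_A(x)=h/g\in\mathbb C(x_1,\dots,x_d)$, which does not depend on the choice of $g$ and $h$.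 If $A\cap\mathbb Z^d$ is finite, then $\sigma_A(x)$ is the Laurent polynomial $\sum_{m\in A\cap\mathbb Z^d}x^m$. For each vertex $v$ of $P$ choose a vector $\xi_v\in\mathbb R^d$ that is not perpendicular to any edge direction at $v$. Then $P\cap\mathbb Z^d$ is finite, each series $S_{K_{\xi_v,v}}$ represents a rational function, and in $\mathbb C(x_1,\dots,x_d)$ $$\sigma_P(x)\;=\;\sum_{v\text{ a vertex of }P}(-1)^{|E^-_v(\xi_v)|}\,\sigma_{K_{\xi_v,v}}(x).$$ -/

import Mathlib

noncomputable section

open scoped Classical RealInnerProductSpace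

namespace LawrenceVarchenko

/-! ### Polytopes, vertices, edges -/

/-- A polytope in `ℝ^d`: the convex hull of a finite set of points. -/
structure Polytope (d : ℕ) where
  carrier : Set (EuclideanSpace ℝ (Fin d))
  exists_finset : ∃ s : Finset (EuclideanSpace ℝ (Fin d)),
    carrier = convexHull ℝ (s : Set (EuclideanSpace ℝ (Fin d)))

namespace Polytope

variable {d : ℕ} (P : Polytope d)

theorem finite_extremePoints : (P.carrier.extremePoints ℝ).Finite := by
  obtain ⟨s, hs⟩ := P.exists_finset
  rw [hs]
  exact s.finite_toSet.subset extremePoints_convexHull_subset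

/-- The vertices of a polytope are its extreme points. -/
def vertices : Finset (EuclideanSpace ℝ (Fin d)) :=
  P.finite_extremePoints.toFinset

/-- The segment `[v, u]` between two distinct vertices is an edge
if it is a face, that is, the set of maximizers on `P` of some linear functional. -/
def IsEdge (v u : EuclideanSpace ℝ (Fin d)) : Prop :=
  v ∈ P.vertices ∧ u ∈ P.vertices ∧ u ≠ v ∧ IsExposed ℝ P.carrier (segment ℝ v u)

/-- The edge directions at `v`: the vectors `u - v`, one for each edge `[v, u]` of `P` at `v`. -/
def edgeDirections (v : EuclideanSpace ℝ (Fin d)) : Finset (EuclideanSpace ℝ (Fin d)) :=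
  (P.vertices.filter fun u => P.IsEdge v u).image fun u => u - v

/-- `P ⊆ ℝ^d` is a simple `d`-polytope: it has dimension `d`, and every vertex lies on exactly
`d` edges. -/
def IsSimple : Prop :=
  affineSpan ℝ P.carrier = ⊤ ∧ ∀ v ∈ P.vertices, (P.edgeDirections v).card = d

/-- Every edge of `P` is parallel to a vector with integer coordinates. -/
def HasRationalEdges : Prop :=
  ∀ v ∈ P.vertices, ∀ w ∈ P.edgeDirections v,
    ∃ (z : Fin d → ℤ) (c : ℝ), ∀ i, w i = c * (z i : ℝ)

/-- `E⁺_v(ξ)`: the edge directions at `v` with positive dot product with `ξ`. -/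
def posEdges (ξ v : EuclideanSpace ℝ (Fin d)) : Finset (EuclideanSpace ℝ (Fin d)) :=
  (P.edgeDirections v).filter fun w => 0 < ⟪w, ξ⟫

/-- `E⁻_v(ξ)`: the edge directions at `v` with negative dot product with `ξ`. -/
def negEdges (ξ v : EuclideanSpace ℝ (Fin d)) : Finset (EuclideanSpace ℝ (Fin d)) :=
  (P.edgeDirections v).filter fun w => ⟪w, ξ⟫ < 0

/-- The half-open cone `K_{ξ,v} = v + ∑_{w ∈ E⁺} ℝ_{≥0} w + ∑_{w ∈ E⁻} ℝ_{<0} w`. -/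
def halfOpenCone (ξ v : EuclideanSpace ℝ (Fin d)) : Set (EuclideanSpace ℝ (Fin d)) :=
  {x | ∃ c : EuclideanSpace ℝ (Fin d) → ℝ,
    (∀ w ∈ P.posEdges ξ v, 0 ≤ c w) ∧ (∀ w ∈ P.negEdges ξ v, c w < 0) ∧
    x = v + ∑ w ∈ P.posEdges ξ v, c w • w + ∑ w ∈ P.negEdges ξ v, c w • w}

end Polytope

/-! ### Formal Laurent series and their rational functions -/

/-- Laurent polynomials `ℂ[x₁^{±1}, …, x_d^{±1}]`; the monomial `x^m` is `single m 1`. -/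
abbrev LaurentPoly (d : ℕ) : Type := AddMonoidAlgebra ℂ (Fin d → ℤ)

/-- Rational functions `ℂ(x₁, …, x_d)`, the quotient field of the Laurent polynomials. -/
abbrev RationalFunction (d : ℕ) : Type := FractionRing (LaurentPoly d)

/-- Formal Laurent series `ℂ[[x₁^{±1}, …, x_d^{±1}]]`: arbitrary families of coefficients. -/
abbrev FormalSeries (d : ℕ) : Type := (Fin d → ℤ) → ℂ

/-- The product of a Laurent polynomial and a formal Laurent series. -/
def polyMul {d : ℕ} (g : LaurentPoly d) (S : FormalSeries d) : FormalSeries d :=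
  fun m => g.coeff.sum fun a b => b * S (m - a)

/-- The integer points of `ℝ^d`. -/
def latticePoint {d : ℕ} (m : Fin d → ℤ) : EuclideanSpace ℝ (Fin d) :=
  WithLp.toLp 2 fun i => (m i : ℝ)

/-- The formal series `S_A = ∑_{m ∈ A ∩ ℤ^d} x^m`. -/
def latticeSeries {d : ℕ} (A : Set (EuclideanSpace ℝ (Fin d))) : FormalSeries d :=
  fun m => if latticePoint m ∈ A then 1 else 0

/-- The formal series `S` represents the rational function `f`: there is a nonzero Laurent
polynomial `g` such that `g S` is a Laurent polynomial `h`, and `f = h / g`. -/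
def Represents {d : ℕ} (S : FormalSeries d) (f : RationalFunction d) : Prop :=
  ∃ g h : LaurentPoly d, g ≠ 0 ∧ polyMul g S = (fun m => h.coeff m) ∧
    f = algebraMap (LaurentPoly d) (RationalFunction d) h / algebraMap (LaurentPoly d) (RationalFunction d) g

/-- The integer-point generating function `σ_A(x)` as a rational function: the rational function
represented by the series `S_A`. It is unique (`Represents.unique`); the value is `0` if `S_A`
represents no rational function. -/
def sigma {d : ℕ} (A : Set (EuclideanSpace ℝ (Fin d))) : RationalFunction d :=
  if h : ∃ f, Represents (latticeSeries A) f then h.choose else 0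

/-! ### The rational function of a formal series is well defined -/

/-- Translation of coefficients, i.e. multiplication of formal series by monomials. -/
def shift (d : ℕ) : Multiplicative (Fin d → ℤ) →* Module.End ℂ (FormalSeries d) where
  toFun a :=
    { toFun := fun S m => S (m - a.toAdd)
      map_add' := fun _ _ => rfl
      map_smul' := fun _ _ => rfl }
  map_one' := by ext S m; simp
  map_mul' a b := by
    refine LinearMap.ext fun S => funext fun m => ?_
    change S (m - (a.toAdd + b.toAdd)) = S (m - a.toAdd - b.toAdd)
    rw [sub_sub]

theorem polyMul_eq_lift {d : ℕ} (g : LaurentPoly d) (S : FormalSeries d) :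
    polyMul g S = AddMonoidAlgebra.lift ℂ _ _ (shift d) g S := by
  funext m
  rw [AddMonoidAlgebra.lift_apply]
  simp [polyMul, Finsupp.sum, shift]

theorem polyMul_mul {d : ℕ} (g h : LaurentPoly d) (S : FormalSeries d) :
    polyMul (g * h) S = polyMul g (polyMul h S) := by
  simp only [polyMul_eq_lift, map_mul]
  rfl

theorem polyMul_coeff {d : ℕ} (g h : LaurentPoly d) :
    polyMul g (fun m => h.coeff m) = fun m => (g * h).coeff m := by
  induction g using AddMonoidAlgebra.induction_on with
  | of a =>
    funext m
    rw [polyMul_eq_lift, AddMonoidAlgebra.lift_of]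
    simp [shift, sub_eq_neg_add]
  | add x y hx hy =>
    rw [polyMul_eq_lift] at hx hy ⊢
    rw [map_add, LinearMap.add_apply, hx, hy]
    funext m
    simp [add_mul]
  | smul r x hx =>
    rw [polyMul_eq_lift] at hx ⊢
    rw [map_smul, LinearMap.smul_apply, hx]
    funext m
    simp

theorem Represents.unique {d : ℕ} {S : FormalSeries d} {f f' : RationalFunction d}
    (hf : Represents S f) (hf' : Represents S f') : f = f' := by
  obtain ⟨g, h, hg, hS, rfl⟩ := hf
  obtain ⟨g', h', hg', hS', rfl⟩ := hf'
  have inj := IsFractionRing.injective (LaurentPoly d) (RationalFunction d)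
  have key : g' * h = g * h' := by
    have h1 := polyMul_mul g' g S
    have h2 := polyMul_mul g g' S
    rw [hS, polyMul_coeff] at h1
    rw [hS', polyMul_coeff, mul_comm g g', h1] at h2
    ext m
    exact congrFun h2 m
  rw [div_eq_div_iff (by simpa using hg) (by simpa using hg'), ← map_mul, ← map_mul,
    mul_comm h g', mul_comm h' g, key]

theorem Represents.sigma_eq {d : ℕ} {A : Set (EuclideanSpace ℝ (Fin d))} {f : RationalFunction d}
    (hf : Represents (latticeSeries A) f) : sigma A = f := by
  have h : ∃ f, Represents (latticeSeries A) f := ⟨f, hf⟩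
  rw [sigma, dif_pos h]
  exact h.choose_spec.unique hf

/-- If `A` has only finitely many integer points, then `σ_A(x)` is the Laurent polynomial
`∑_{m ∈ A ∩ ℤ^d} x^m`. -/
theorem sigma_of_finite {d : ℕ} {A : Set (EuclideanSpace ℝ (Fin d))}
    (hA : {m : Fin d → ℤ | latticePoint m ∈ A}.Finite) :
    sigma A = algebraMap (LaurentPoly d) (RationalFunction d)
      (∑ m ∈ hA.toFinset, AddMonoidAlgebra.single m 1) := by
  apply Represents.sigma_eq
  refine ⟨1, ∑ m ∈ hA.toFinset, AddMonoidAlgebra.single m 1, one_ne_zero, ?_, ?_⟩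
  · rw [polyMul_eq_lift, map_one]
    funext m
    simp [latticeSeries, Finsupp.single_apply, Finsupp.finsetSum_apply]
  · rw [map_one, div_one]

end LawrenceVarchenko

end

/-!
For a vertex `v`, let `c_w` be the coordinates with respect to the basis of the edge directions
`w` at `v`. Up to the sign `(-1) ^ |E⁻_v(ξ)|`, the indicator function of the half-open cone
`K_{ξ,v}` at a point `x` is the product over `w` of `[c_w(x - v) ≥ 0] - [⟨w, ξ⟩ < 0]`. This product
is `vertexTerm`; two facts about it give the result.

*The rational function does not depend on `ξ`.* Multiply the series of this product by the product
of the factors `1 - x ^ z_w`, where the integer vector `z_w` is a positive multiple of `w`. Each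
factor acts as a difference operator on the corresponding factor of `vertexTerm` and kills the
constant `[⟨w, ξ⟩ < 0]`. What remains is the indicator function of a half-open parallelepiped, a
Laurent polynomial (`exists_forall_represents_vertexTerm`). So all the `ξ_v` may be replaced by one
generic `ξ`.

*For one generic `ξ`, the products add up to the indicator function of the polytope.* At a point of
`P`, only the vertex at which `ξ` is minimal contributes (`sum_vertexTerm_of_mem`). At a point `x`
outside `P`, move `ξ` to a vector that separates `x` from `P`, for which all products vanish at `x`
(`sum_vertexTerm_of_notMem`). Along a general line this crosses the walls `w^⊥` one at a time at
each vertex. When `ξ` crosses the wall of an edge `[v, u]`, only the factors of this edge jump at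
`v` and at `u`, in opposite directions, and the remaining factors at `v` and at `u` agree in pairs,
so that the sum does not change (`vertexTerm_jump_add`).

The polyhedral input is that the cone of a polytope at a vertex is generated by the edge directions
(`sub_mem_span_edgeDirections`), and that the edges at the two ends of an edge of a simple polytope
correspond to each other (`exists_transverse_partner`): the transition matrices between the
transverse coordinates are nonnegative and inverse to each other, hence monomial.
-/

noncomputable section

open scoped Classical RealInnerProductSpace NNReal Topology
open Filter

namespace LawrenceVarchenko

/-! ### Finitely generated cones -/

theorem exists_minimal_generators {M : Type*} [AddCommMonoid M] [Module ℝ≥0 M] (A : Finset M) :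
    ∃ B ⊆ A, (A : Set M) ⊆ Submodule.span ℝ≥0 (B : Set M) ∧
      ∀ b ∈ B, b ∉ Submodule.span ℝ≥0 ((B.erase b : Finset M) : Set M) := by
  obtain ⟨B, hB, hmin⟩ := Finset.exists_min_image
    (A.powerset.filter fun B : Finset M => (A : Set M) ⊆ Submodule.span ℝ≥0 (B : Set M))
    Finset.card
    ⟨A, by simp⟩
  simp only [Finset.mem_filter, Finset.mem_powerset] at hB hmin
  refine ⟨B, hB.1, hB.2, fun b hb hmem => ?_⟩
  have hle : Submodule.span ℝ≥0 (B : Set M) ≤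
      Submodule.span ℝ≥0 ((B.erase b : Finset M) : Set M) := by
    rw [Submodule.span_le]
    intro x hx
    by_cases hxb : x = b
    · exact hxb ▸ hmem
    · exact Submodule.subset_span (by simpa [hxb] using hx)
  have := hmin (B.erase b) ⟨(Finset.erase_subset b B).trans hB.1, fun x hx => hle (hB.2 hx)⟩
  exact absurd this (not_le.2 (Finset.card_erase_lt_of_mem hb))

theorem mem_nnrealSpan_finset {M : Type*} [AddCommGroup M] [Module ℝ M] {B : Finset M} {x : M} :
    x ∈ Submodule.span ℝ≥0 (B : Set M) ↔
      ∃ c : M → ℝ, (∀ b, 0 ≤ c b) ∧ ∑ b ∈ B, c b • b = x := by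
  rw [Submodule.mem_span_finset]
  constructor
  · rintro ⟨f, -, rfl⟩
    exact ⟨fun b => f b, fun b => (f b).2, rfl⟩
  · rintro ⟨c, hc, rfl⟩
    refine ⟨fun b => if b ∈ B then ⟨c b, hc b⟩ else 0, fun b hb => ?_, ?_⟩
    · by_contra h
      simp_all
    · refine Finset.sum_congr rfl fun b hb => ?_
      simp only [hb]
      rfl

/-- An irredundant generator of a pointed, finitely generated cone spans an exposed ray. -/
theorem exists_functional_of_irredundant {M : Type*} [NormedAddCommGroup M] [NormedSpace ℝ M]
    {B : Finset M} {f₀ : M →L[ℝ] ℝ} (hf₀ : ∀ b ∈ B, 0 < f₀ b) {b : M} (hb : b ∈ B)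
    (hirr : b ∉ Submodule.span ℝ≥0 ((B.erase b : Finset M) : Set M)) :
    ∃ f : M →L[ℝ] ℝ, f b = 0 ∧ ∀ b' ∈ B, b' ≠ b → 0 < f b' := by
  have hdisj : Disjoint (convexHull ℝ ((B.erase b : Finset M) : Set M))
      (Submodule.span ℝ {b} : Set M) := by
    rw [Set.disjoint_left]
    intro x hx hxb
    rw [Finset.convexHull_eq] at hx
    obtain ⟨c, hc, hc1, rfl⟩ := hx
    obtain ⟨t, ht⟩ := Submodule.mem_span_singleton.1 hxb
    rw [Finset.centerMass_eq_of_sum_1 _ _ hc1] at ht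
    simp only [id] at ht
    have hpos : 0 < f₀ (t • b) := by
      rw [ht, map_sum]
      obtain ⟨i, hi, hi0⟩ : ∃ i ∈ B.erase b, c i ≠ 0 :=
        Finset.exists_ne_zero_of_sum_ne_zero (by rw [hc1]; exact one_ne_zero)
      refine Finset.sum_pos' (fun j hj => ?_) ⟨i, hi, ?_⟩
      · rw [map_smul, smul_eq_mul]
        exact mul_nonneg (hc j hj) (hf₀ j (Finset.mem_of_mem_erase hj)).le
      · rw [map_smul, smul_eq_mul]
        exact mul_pos ((hc i hi).lt_of_ne' hi0) (hf₀ i (Finset.mem_of_mem_erase hi))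
    rw [map_smul, smul_eq_mul] at hpos
    have htpos : 0 < t := pos_of_mul_pos_left hpos (hf₀ b hb).le
    refine hirr (mem_nnrealSpan_finset.2
      ⟨fun i => if i ∈ B.erase b then t⁻¹ * c i else 0, fun i => ?_, ?_⟩)
    · dsimp only
      split_ifs with hi
      · exact mul_nonneg (inv_nonneg.2 htpos.le) (hc i hi)
      · exact le_rfl
    · rw [Finset.sum_congr rfl (g := fun i => t⁻¹ • (c i • i))
        (fun i hi => by simp only [if_pos hi, mul_smul]), ← Finset.smul_sum, ← ht,
        inv_smul_smul₀ htpos.ne']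
  obtain ⟨f, s, t, hs, hst, ht⟩ := geometric_hahn_banach_compact_closed
    (convex_convexHull ℝ _) ((B.erase b).finite_toSet.isCompact_convexHull (𝕜 := ℝ))
    (Submodule.convex _) (Submodule.closed_of_finiteDimensional _) hdisj
  -- a functional bounded below on a line vanishes on it
  have hfb : f b = 0 := by
    by_contra hne
    have := ht (((t - 1) / f b) • b) (Submodule.smul_mem _ _ (Submodule.mem_span_singleton_self b))
    rw [map_smul, smul_eq_mul, div_mul_cancel₀ _ hne] at this
    linarith
  have ht0 : t < 0 := by simpa using ht 0 (Submodule.zero_mem _)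
  refine ⟨-f, by simp [hfb], fun b' hb' hne => ?_⟩
  have := hs b' (subset_convexHull ℝ _ (by simp [hb', hne]))
  simp only [neg_apply]
  linarith

/-! ### The cone of a polytope at a vertex -/

namespace Polytope

variable {d : ℕ} (P : Polytope d)

theorem isCompact_carrier : IsCompact P.carrier := by
  obtain ⟨s, hs⟩ := P.exists_finset
  rw [hs]
  exact s.finite_toSet.isCompact_convexHull (𝕜 := ℝ)

theorem convex_carrier : Convex ℝ P.carrier := by
  obtain ⟨s, hs⟩ := P.exists_finset
  rw [hs]
  exact convex_convexHull ℝ _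

theorem mem_vertices {v : EuclideanSpace ℝ (Fin d)} :
    v ∈ P.vertices ↔ v ∈ P.carrier.extremePoints ℝ := by
  simp [vertices]

theorem vertices_subset_carrier {v : EuclideanSpace ℝ (Fin d)} (hv : v ∈ P.vertices) :
    v ∈ P.carrier :=
  extremePoints_subset (P.mem_vertices.1 hv)

theorem convexHull_vertices :
    convexHull ℝ (P.vertices : Set (EuclideanSpace ℝ (Fin d))) = P.carrier := by
  have h := closure_convexHull_extremePoints P.isCompact_carrier P.convex_carrier
  have h' : (P.vertices : Set (EuclideanSpace ℝ (Fin d))) = P.carrier.extremePoints ℝ := by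
    ext v
    exact P.mem_vertices
  rwa [← h', (P.vertices.finite_toSet.isCompact_convexHull (𝕜 := ℝ)).isClosed.closure_eq] at h

theorem mem_edgeDirections {v w : EuclideanSpace ℝ (Fin d)} :
    w ∈ P.edgeDirections v ↔ P.IsEdge v (v + w) := by
  simp only [edgeDirections, Finset.mem_image, Finset.mem_filter]
  constructor
  · rintro ⟨u, ⟨-, hu⟩, rfl⟩
    simpa using hu
  · intro h
    exact ⟨v + w, ⟨h.2.1, h⟩, by simp⟩

variable {P}

theorem neg_mem_edgeDirections {v w : EuclideanSpace ℝ (Fin d)}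
    (hw : w ∈ P.edgeDirections v) : -w ∈ P.edgeDirections (v + w) := by
  rw [mem_edgeDirections] at hw ⊢
  obtain ⟨h1, h2, h3, h4⟩ := hw
  refine ⟨h2, by simpa using h1, by simpa using h3, ?_⟩
  rw [segment_symm] at h4
  simpa using h4

/-- Some linear functional attains its minimum over the polytope at the given vertex only. -/
theorem exists_functional_vertex {v : EuclideanSpace ℝ (Fin d)} (hv : v ∈ P.vertices) :
    ∃ f : EuclideanSpace ℝ (Fin d) →L[ℝ] ℝ, ∀ u ∈ P.vertices, u ≠ v → 0 < f (u - v) := by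
  have hnot :
      v ∉ convexHull ℝ ((P.vertices.erase v : Finset _) : Set (EuclideanSpace ℝ (Fin d))) := by
    intro hmem
    have hsub : convexHull ℝ ((P.vertices.erase v : Finset _) : Set (EuclideanSpace ℝ (Fin d)))
        ⊆ P.carrier :=
      convexHull_min (fun x hx => P.vertices_subset_carrier (Finset.mem_of_mem_erase hx))
        P.convex_carrier
    have hext := inter_extremePoints_subset_extremePoints_of_subset hsub
      ⟨hmem, P.mem_vertices.1 hv⟩
    simpa using extremePoints_convexHull_subset hext
  obtain ⟨f, s, h1, h2⟩ := geometric_hahn_banach_point_closed (convex_convexHull ℝ _)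
    ((P.vertices.erase v).finite_toSet.isCompact_convexHull (𝕜 := ℝ)).isClosed hnot
  refine ⟨f, fun u hu hne => ?_⟩
  have := h2 u (subset_convexHull ℝ _ (by simp [hu, hne]))
  rw [map_sub]
  linarith

/-- The cone of a polytope at a vertex is generated by the edges there. Indeed, an irredundant
generator `u - v`, with `u` another vertex, spans an exposed ray of the cone, so that `[v, u]` is
an edge. -/
theorem sub_mem_span_edgeDirections {v x : EuclideanSpace ℝ (Fin d)} (hv : v ∈ P.vertices)
    (hx : x ∈ P.carrier) :
    x - v ∈ Submodule.span ℝ≥0 (P.edgeDirections v : Set (EuclideanSpace ℝ (Fin d))) := by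
  obtain ⟨f₀, hf₀⟩ := exists_functional_vertex hv
  obtain ⟨B, hBA, hgen, hirr⟩ :=
    exists_minimal_generators ((P.vertices.erase v).image fun u => u - v)
  have hB : ∀ b ∈ B, v + b ∈ P.vertices ∧ b ≠ 0 := by
    intro b hb
    obtain ⟨u, hu, rfl⟩ := Finset.mem_image.1 (hBA hb)
    rw [Finset.mem_erase] at hu
    exact ⟨by simpa using hu.2, sub_ne_zero.2 hu.1⟩
  have hcone : ∀ y ∈ P.carrier, y - v ∈ Submodule.span ℝ≥0 (B : Set _) := by
    intro y hy
    rw [← P.convexHull_vertices, Finset.convexHull_eq] at hy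
    obtain ⟨c, hc, hc1, rfl⟩ := hy
    have : P.vertices.centerMass c id - v = ∑ u ∈ P.vertices, c u • (u - v) := by
      rw [Finset.centerMass_eq_of_sum_1 _ _ hc1]
      simp [smul_sub, ← Finset.sum_smul, hc1]
    rw [this]
    refine Submodule.sum_mem _ fun u hu => ?_
    have hmem : u - v ∈ Submodule.span ℝ≥0 (B : Set _) := by
      by_cases huv : u = v
      · simp [huv]
      · exact hgen (by
          simp only [Finset.coe_image, Set.mem_image, Finset.mem_coe, Finset.mem_erase]
          exact ⟨u, ⟨huv, hu⟩, rfl⟩)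
    exact Submodule.smul_mem _ (⟨c u, hc u hu⟩ : ℝ≥0) hmem
  refine Submodule.span_mono (fun b hb => ?_) (hcone x hx)
  obtain ⟨hbv, hb0⟩ := hB b hb
  obtain ⟨f, hfb, hf⟩ := exists_functional_of_irredundant (f₀ := f₀) (fun b hb => by
    have := hf₀ _ (hB b hb).1 (by simpa using (hB b hb).2)
    simpa using this) hb (hirr b hb)
  rw [Finset.mem_coe, mem_edgeDirections]
  refine ⟨hv, hbv, by simpa using hb0, fun _ => ⟨-f, ?_⟩⟩
  have hvP := P.vertices_subset_carrier hv
  have hbP := P.vertices_subset_carrier hbv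
  have hnonneg : ∀ y ∈ P.carrier, 0 ≤ f (y - v) ∧
      (f (y - v) = 0 → ∃ t : ℝ, 0 ≤ t ∧ y = v + t • b) := by
    intro y hy
    obtain ⟨c, hc, hcy⟩ := mem_nnrealSpan_finset.1 (hcone y hy)
    have hterm : ∀ b' ∈ B, 0 ≤ c b' * f b' := fun b' hb' => by
      by_cases h : b' = b
      · simp [h, hfb]
      · exact mul_nonneg (hc b') (hf b' hb' h).le
    have hfy : f (y - v) = ∑ b' ∈ B, c b' * f b' := by
      rw [← hcy, map_sum]
      simp
    refine ⟨hfy ▸ Finset.sum_nonneg hterm, fun h0 => ⟨c b, hc b, ?_⟩⟩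
    rw [hfy, Finset.sum_eq_zero_iff_of_nonneg hterm] at h0
    rw [Finset.sum_eq_single b] at hcy
    · rw [hcy]
      abel
    · intro b' hb' hne
      have := (mul_eq_zero.1 (h0 b' hb')).resolve_right (hf b' hb' hne).ne'
      rw [this, zero_smul]
    · exact fun h => absurd hb h
  ext y
  simp only [neg_apply, neg_le_neg_iff, Set.mem_ofPred_eq]
  constructor
  · intro hy
    refine ⟨P.convex_carrier.segment_subset hvP hbP hy, fun z hz => ?_⟩
    have hfy : f y = f v := by
      rw [segment_eq_image'] at hy
      obtain ⟨t, -, rfl⟩ := hy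
      simp [hfb]
    have := (hnonneg z hz).1
    rw [map_sub] at this
    linarith
  · rintro ⟨hy, hmin⟩
    have h1 := hmin v hvP
    obtain ⟨h2, h3⟩ := hnonneg y hy
    rw [map_sub] at h2 h3
    obtain ⟨t, ht, rfl⟩ := h3 (le_antisymm (by linarith) h2)
    -- the vertex `v + b` is not in the interior of a longer segment starting at `v`
    have ht1 : t ≤ 1 := by
      by_contra! hlt
      have h4 := (P.mem_vertices.1 hbv).2 hvP hy ⟨1 - t⁻¹, t⁻¹,
        sub_pos.2 (inv_lt_one_of_one_lt₀ hlt), by positivity, by ring, by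
          rw [smul_add, smul_smul, inv_mul_cancel₀ (by positivity), one_smul, ← add_assoc,
            ← add_smul]
          simp⟩
      exact hb0 (by simpa using h4.symm)
    rw [segment_eq_image']
    exact ⟨t, ⟨ht, ht1⟩, by simp⟩

end Polytope

/-! ### Coordinates at a vertex of a simple polytope -/

namespace Polytope

variable {d : ℕ} {P : Polytope d}

theorem span_edgeDirections_eq_top (hP : P.IsSimple) {v : EuclideanSpace ℝ (Fin d)}
    (hv : v ∈ P.vertices) :
    Submodule.span ℝ (P.edgeDirections v : Set (EuclideanSpace ℝ (Fin d))) = ⊤ := by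
  have hvP := P.vertices_subset_carrier hv
  have h1 := hP.1
  have h2 : vectorSpan ℝ P.carrier = ⊤ := by
    rw [← direction_affineSpan, h1, AffineSubspace.direction_top]
  rw [eq_top_iff, ← h2, vectorSpan_eq_span_vsub_set_right ℝ hvP, Submodule.span_le]
  rintro _ ⟨x, hx, rfl⟩
  obtain ⟨c, -, hc⟩ := mem_nnrealSpan_finset.1 (sub_mem_span_edgeDirections hv hx)
  change x - v ∈ _
  rw [← hc]
  exact Submodule.sum_mem _ fun w hw => Submodule.smul_mem _ _ (Submodule.subset_span hw)

variable (P) in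
/-- The edge directions at `v` form a basis with coordinate functionals `l w`. -/
def IsEdgeDual (v : EuclideanSpace ℝ (Fin d))
    (l : EuclideanSpace ℝ (Fin d) → EuclideanSpace ℝ (Fin d) →ₗ[ℝ] ℝ) : Prop :=
  (∀ x, ∑ w ∈ P.edgeDirections v, l w x • w = x) ∧
    ∀ w ∈ P.edgeDirections v, ∀ w' ∈ P.edgeDirections v, l w w' = if w = w' then 1 else 0

theorem exists_isEdgeDual (hP : P.IsSimple) {v : EuclideanSpace ℝ (Fin d)}
    (hv : v ∈ P.vertices) : ∃ l, P.IsEdgeDual v l := by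
  have hspan := span_edgeDirections_eq_top hP hv
  have hli : LinearIndependent ℝ
      (fun w : P.edgeDirections v => (w : EuclideanSpace ℝ (Fin d))) := by
    refine linearIndependent_of_top_le_span_of_card_eq_finrank ?_ ?_
    · simpa using hspan.ge
    · simpa using hP.2 v hv
  let B := Module.Basis.mk hli (by simpa using hspan.ge)
  have hB : ∀ w, B w = (w : EuclideanSpace ℝ (Fin d)) := fun w => Module.Basis.mk_apply _ _ w
  refine ⟨fun w => if h : w ∈ P.edgeDirections v then B.coord ⟨w, h⟩ else 0, fun x => ?_,
    fun w hw w' hw' => ?_⟩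
  · rw [← Finset.sum_attach]
    conv_rhs => rw [← B.sum_repr x]
    simp [hB]
  · simp only [dif_pos hw]
    have := hB ⟨w', hw'⟩
    change B.repr w' ⟨w, hw⟩ = _
    conv_lhs => rw [show w' = B ⟨w', hw'⟩ from this.symm]
    rw [B.repr_self, Finsupp.single_apply]
    simp [eq_comm]

variable (P) in
/-- The coordinate of `x` along the edge direction `w`, in the basis of the edge directions at
the vertex `v`; the value is junk if these do not form a basis. -/
def edgeCoord (v : EuclideanSpace ℝ (Fin d)) :
    EuclideanSpace ℝ (Fin d) → EuclideanSpace ℝ (Fin d) →ₗ[ℝ] ℝ :=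
  if h : ∃ l, P.IsEdgeDual v l then h.choose else 0

theorem isEdgeDual_edgeCoord (hP : P.IsSimple) {v : EuclideanSpace ℝ (Fin d)}
    (hv : v ∈ P.vertices) : P.IsEdgeDual v (P.edgeCoord v) := by
  rw [edgeCoord, dif_pos (exists_isEdgeDual hP hv)]
  exact (exists_isEdgeDual hP hv).choose_spec

theorem sum_edgeCoord_smul (hP : P.IsSimple) {v : EuclideanSpace ℝ (Fin d)}
    (hv : v ∈ P.vertices) (x : EuclideanSpace ℝ (Fin d)) :
    ∑ w ∈ P.edgeDirections v, P.edgeCoord v w x • w = x :=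
  (isEdgeDual_edgeCoord hP hv).1 x

theorem edgeCoord_self (hP : P.IsSimple) {v w : EuclideanSpace ℝ (Fin d)}
    (hv : v ∈ P.vertices) (hw : w ∈ P.edgeDirections v) : P.edgeCoord v w w = 1 := by
  rw [(isEdgeDual_edgeCoord hP hv).2 w hw w hw, if_pos rfl]

theorem edgeCoord_of_ne (hP : P.IsSimple) {v w w' : EuclideanSpace ℝ (Fin d)}
    (hv : v ∈ P.vertices) (hw : w ∈ P.edgeDirections v) (hw' : w' ∈ P.edgeDirections v)
    (hne : w ≠ w') : P.edgeCoord v w w' = 0 := by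
  rw [(isEdgeDual_edgeCoord hP hv).2 w hw w' hw', if_neg hne]

theorem edgeCoord_sum (hP : P.IsSimple) {v w : EuclideanSpace ℝ (Fin d)}
    (hv : v ∈ P.vertices) (hw : w ∈ P.edgeDirections v) (c : EuclideanSpace ℝ (Fin d) → ℝ) :
    P.edgeCoord v w (∑ w' ∈ P.edgeDirections v, c w' • w') = c w := by
  rw [map_sum, Finset.sum_eq_single w]
  · rw [map_smul, edgeCoord_self hP hv hw, smul_eq_mul, mul_one]
  · intro w' hw' hne
    rw [map_smul, edgeCoord_of_ne hP hv hw hw' hne.symm, smul_zero]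
  · exact fun h => absurd hw h

theorem edgeCoord_sub_nonneg (hP : P.IsSimple) {v w x : EuclideanSpace ℝ (Fin d)}
    (hv : v ∈ P.vertices) (hw : w ∈ P.edgeDirections v) (hx : x ∈ P.carrier) :
    0 ≤ P.edgeCoord v w (x - v) := by
  obtain ⟨c, hc, h⟩ := mem_nnrealSpan_finset.1 (sub_mem_span_edgeDirections hv hx)
  rw [← h, edgeCoord_sum hP hv hw]
  exact hc w

theorem ne_zero_of_mem_edgeDirections {v w : EuclideanSpace ℝ (Fin d)}
    (hw : w ∈ P.edgeDirections v) : w ≠ 0 := by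
  rintro rfl
  rw [mem_edgeDirections] at hw
  exact hw.2.2.1 (by simp)

/-- Two edge directions at a vertex of a simple polytope are not parallel. -/
theorem smul_sub_smul_ne_zero (hP : P.IsSimple) {v w w' : EuclideanSpace ℝ (Fin d)}
    (hv : v ∈ P.vertices) (hw : w ∈ P.edgeDirections v) (hw' : w' ∈ P.edgeDirections v)
    (hne : w ≠ w') {a : ℝ} (ha : a ≠ 0) (b : ℝ) : a • w - b • w' ≠ 0 := by
  intro h
  have := congrArg (P.edgeCoord v w) h
  rw [map_sub, map_smul, map_smul, edgeCoord_self hP hv hw,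
    edgeCoord_of_ne hP hv hw hw' hne] at this
  simp [ha] at this

/-! ### The two ends of an edge -/

/-- The coordinates at `v` transverse to an edge `[v, v + w₀]` are nonnegative on the edge
directions at the other end. They are linear functions that vanish on this edge, and their minimum
over the polytope is attained at `v`, hence also at `v + w₀`. -/
theorem edgeCoord_nonneg_other_end (hP : P.IsSimple) {v w₀ w y : EuclideanSpace ℝ (Fin d)}
    (hv : v ∈ P.vertices) (hw₀ : w₀ ∈ P.edgeDirections v) (hw : w ∈ P.edgeDirections v)
    (hne : w ≠ w₀) (hy : y ∈ P.edgeDirections (v + w₀)) : 0 ≤ P.edgeCoord v w y := by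
  have h := edgeCoord_sub_nonneg hP hv hw
    (P.vertices_subset_carrier ((P.mem_edgeDirections.1 hy).2.1))
  rwa [show v + w₀ + y - v = y + w₀ by abel, map_add, edgeCoord_of_ne hP hv hw hw₀ hne,
    add_zero] at h

/-- The two transition matrices between the coordinates transverse to an edge `[v, v + w₀]` at its
two ends are inverse to each other. -/
theorem sum_edgeCoord_mul_edgeCoord (hP : P.IsSimple) {v w₀ y y' : EuclideanSpace ℝ (Fin d)}
    (hv : v ∈ P.vertices) (hw₀ : w₀ ∈ P.edgeDirections v)
    (hy' : y' ∈ P.edgeDirections (v + w₀)) (hne' : y' ≠ -w₀) :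
    ∑ w ∈ (P.edgeDirections v).erase w₀, P.edgeCoord v w y * P.edgeCoord (v + w₀) y' w =
      P.edgeCoord (v + w₀) y' y := by
  have hu : v + w₀ ∈ P.vertices := (P.mem_edgeDirections.1 hw₀).2.1
  have h0 : P.edgeCoord (v + w₀) y' w₀ = 0 := by
    have := edgeCoord_of_ne hP hu hy' (neg_mem_edgeDirections hw₀) hne'
    rwa [map_neg, neg_eq_zero] at this
  conv_rhs => rw [← sum_edgeCoord_smul hP hv y, ← Finset.add_sum_erase _ _ hw₀, map_add, map_smul,
    h0, smul_zero, zero_add, map_sum]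
  simp

/-- Nonnegative matrices inverse to each other have just one nonzero entry in each row and each
column; here for the transverse coordinates at the two ends of an edge. -/
theorem exists_transverse_partner (hP : P.IsSimple) {v w₀ y : EuclideanSpace ℝ (Fin d)}
    (hv : v ∈ P.vertices) (hw₀ : w₀ ∈ P.edgeDirections v)
    (hy : y ∈ P.edgeDirections (v + w₀)) (hne : y ≠ -w₀) :
    ∃ w ∈ P.edgeDirections v, w ≠ w₀ ∧ 0 < P.edgeCoord v w y ∧
      (∀ w' ∈ P.edgeDirections v, w' ≠ w₀ → w' ≠ w → P.edgeCoord v w' y = 0) ∧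
      ∀ y' ∈ P.edgeDirections (v + w₀), y' ≠ -w₀ → y' ≠ y → P.edgeCoord v w y' = 0 := by
  have hu : v + w₀ ∈ P.vertices := (P.mem_edgeDirections.1 hw₀).2.1
  have hn : -w₀ ∈ P.edgeDirections (v + w₀) := neg_mem_edgeDirections hw₀
  have hvu : v + w₀ + -w₀ = v := by abel
  have hpos₁ : ∀ w ∈ P.edgeDirections v, w ≠ w₀ → ∀ y ∈ P.edgeDirections (v + w₀),
      0 ≤ P.edgeCoord v w y := fun w hw hwne y hy =>
    edgeCoord_nonneg_other_end hP hv hw₀ hw hwne hy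
  have hpos₂ : ∀ y ∈ P.edgeDirections (v + w₀), y ≠ -w₀ → ∀ w ∈ P.edgeDirections v,
      0 ≤ P.edgeCoord (v + w₀) y w := fun y hy hyne w hw =>
    edgeCoord_nonneg_other_end hP hu hn hy hyne (by rwa [hvu])
  have hsum := sum_edgeCoord_mul_edgeCoord hP (y := y) hv hw₀ hy hne
  rw [edgeCoord_self hP hu hy] at hsum
  obtain ⟨w, hw, hne0⟩ := Finset.exists_ne_zero_of_sum_ne_zero
    (by rw [hsum]; exact one_ne_zero)
  rw [Finset.mem_erase] at hw
  have hp : 0 < P.edgeCoord v w y :=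
    (hpos₁ w hw.2 hw.1 y hy).lt_of_ne' (left_ne_zero_of_mul hne0)
  have hq : 0 < P.edgeCoord (v + w₀) y w :=
    (hpos₂ y hy hne w hw.2).lt_of_ne' (right_ne_zero_of_mul hne0)
  refine ⟨w, hw.2, hw.1, hp, fun w' hw' hne₀ hne₁ => ?_, fun y' hy' hne₀ hne₁ => ?_⟩
  · have h := sum_edgeCoord_mul_edgeCoord hP (y := w) (y' := w') hu hn (by rwa [hvu])
      (by rwa [neg_neg])
    rw [hvu, edgeCoord_of_ne hP hv hw' hw.2 hne₁] at h
    have h' := (Finset.sum_eq_zero_iff_of_nonneg fun z hz => mul_nonneg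
      (hpos₂ z (Finset.mem_of_mem_erase hz) (Finset.ne_of_mem_erase hz) w hw.2)
      (hpos₁ w' hw' hne₀ z (Finset.mem_of_mem_erase hz))).1 h y (by simp [hy, hne])
    exact (mul_eq_zero.1 h').resolve_left hq.ne'
  · have h := sum_edgeCoord_mul_edgeCoord hP (y := y') hv hw₀ hy hne
    rw [edgeCoord_of_ne hP hu hy hy' hne₁.symm] at h
    have h' := (Finset.sum_eq_zero_iff_of_nonneg fun z hz => mul_nonneg
      (hpos₁ z (Finset.mem_of_mem_erase hz) (Finset.ne_of_mem_erase hz) y' hy')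
      (hpos₂ y hy hne z (Finset.mem_of_mem_erase hz))).1 h w (by simp [hw])
    exact (mul_eq_zero.1 h').resolve_right hq.ne'

/-- Products over the edges at the two ends of an edge `[v, v + w₀]`, other than this edge, agree
if the factors agree for edges `w` and `y` that lie with it in a common two-dimensional face; for
these, `y` is a positive multiple of `w` modulo `w₀`, and the two coordinates are proportional. -/
theorem prod_erase_other_end (hP : P.IsSimple) {v w₀ : EuclideanSpace ℝ (Fin d)}
    (hv : v ∈ P.vertices) (hw₀ : w₀ ∈ P.edgeDirections v)
    {M : Type*} [CommMonoid M] (F G : EuclideanSpace ℝ (Fin d) → M)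
    (hFG : ∀ w ∈ P.edgeDirections v, w ≠ w₀ → ∀ y ∈ P.edgeDirections (v + w₀), y ≠ -w₀ →
      (∃ q r : ℝ, 0 < q ∧ y = q • w + r • w₀ ∧
        ∀ x, P.edgeCoord v w (x - v) = q * P.edgeCoord (v + w₀) y (x - (v + w₀))) → G y = F w) :
    ∏ w ∈ (P.edgeDirections v).erase w₀, F w =
      ∏ y ∈ (P.edgeDirections (v + w₀)).erase (-w₀), G y := by
  have hu : v + w₀ ∈ P.vertices := (P.mem_edgeDirections.1 hw₀).2.1
  have hn : -w₀ ∈ P.edgeDirections (v + w₀) := neg_mem_edgeDirections hw₀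
  choose! f hf hf0 hfpos hfw hfy using fun y (hy : y ∈ P.edgeDirections (v + w₀)) (hne : y ≠ -w₀) =>
    exists_transverse_partner hP hv hw₀ hy hne
  have hmaps : ∀ y ∈ (P.edgeDirections (v + w₀)).erase (-w₀),
      f y ∈ (P.edgeDirections v).erase w₀ := fun y hy => by
    rw [Finset.mem_erase] at hy ⊢
    exact ⟨hf0 y hy.2 hy.1, hf y hy.2 hy.1⟩
  have hinj : Set.InjOn f ((P.edgeDirections (v + w₀)).erase (-w₀) : Finset _) := by
    intro y hy y' hy' h
    rw [Finset.mem_coe, Finset.mem_erase] at hy hy'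
    by_contra hne
    have h1 := hfy y hy.2 hy.1 y' hy'.2 hy'.1 (Ne.symm hne)
    rw [h] at h1
    exact (hfpos y' hy'.2 hy'.1).ne' h1
  have hcard : ((P.edgeDirections v).erase w₀).card ≤
      ((P.edgeDirections (v + w₀)).erase (-w₀)).card := by
    rw [Finset.card_erase_of_mem hw₀, Finset.card_erase_of_mem hn, hP.2 v hv, hP.2 _ hu]
  refine (Finset.prod_bij (fun y _ => f y) hmaps (fun y hy y' hy' h => hinj hy hy' h) ?_ ?_).symm
  · intro w hw
    obtain ⟨y, hy, h⟩ := Finset.surj_on_of_inj_on_of_card_le (fun y _ => f y) hmaps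
      (fun y y' hy hy' h => hinj hy hy' h) hcard w hw
    exact ⟨y, hy, h.symm⟩
  · intro y hy
    rw [Finset.mem_erase] at hy
    obtain ⟨hy0, hy⟩ := hy
    refine hFG _ (hf y hy hy0) (hf0 y hy hy0) y hy hy0
      ⟨P.edgeCoord v (f y) y, P.edgeCoord v w₀ y, hfpos y hy hy0, ?_, fun x => ?_⟩
    · conv_lhs => rw [← sum_edgeCoord_smul hP hv y, ← Finset.add_sum_erase _ _ hw₀,
        Finset.sum_eq_single (f y) (fun w hw hne => by
          rw [Finset.mem_erase] at hw
          rw [hfw y hy hy0 w hw.2 hw.1 hne, zero_smul])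
        (fun h => absurd (Finset.mem_erase.2 ⟨hf0 y hy hy0, hf y hy hy0⟩) h)]
      rw [add_comm]
    · have h0 : P.edgeCoord v (f y) w₀ = 0 :=
        edgeCoord_of_ne hP hv (hf y hy hy0) hw₀ (hf0 y hy hy0)
      rw [show x - v = x - (v + w₀) + w₀ by abel, map_add, h0, add_zero]
      generalize x - (v + w₀) = z
      conv_lhs => rw [← sum_edgeCoord_smul hP hu z]
      rw [map_sum, Finset.sum_eq_single y]
      · rw [map_smul, smul_eq_mul, mul_comm]
      · intro y' hy' hne
        rw [map_smul]
        by_cases h : y' = -w₀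
        · rw [h, map_neg, h0, neg_zero, smul_zero]
        · rw [hfy y hy hy0 y' hy' h hne, smul_zero]
      · exact fun h => absurd hy h

/-! ### Signed indicator functions of half-open cones -/

variable (P) in
/-- The signed indicator function of the half-open cone at `v` in which the edge directions in `N`
are reversed: the product over the edges of `[c ≥ 0]`, and of `-[c < 0] = [c ≥ 0] - 1` for a
reversed edge, where `c` is the coordinate of `x - v` along the edge. -/
def vertexTerm (v : EuclideanSpace ℝ (Fin d)) (N : Set (EuclideanSpace ℝ (Fin d)))
    (x : EuclideanSpace ℝ (Fin d)) : ℂ :=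
  ∏ w ∈ P.edgeDirections v,
    ((if 0 ≤ P.edgeCoord v w (x - v) then 1 else 0) - (if w ∈ N then 1 else 0))

theorem vertexTerm_congr {v : EuclideanSpace ℝ (Fin d)} {N N' : Set (EuclideanSpace ℝ (Fin d))}
    (h : ∀ w ∈ P.edgeDirections v, w ∈ N ↔ w ∈ N') (x : EuclideanSpace ℝ (Fin d)) :
    P.vertexTerm v N x = P.vertexTerm v N' x :=
  Finset.prod_congr rfl fun w hw => by simp only [h w hw]

theorem mem_halfOpenCone_iff (hP : P.IsSimple) {v ξ : EuclideanSpace ℝ (Fin d)}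
    (hv : v ∈ P.vertices) (hξ : ∀ w ∈ P.edgeDirections v, ⟪w, ξ⟫ ≠ 0)
    (x : EuclideanSpace ℝ (Fin d)) :
    x ∈ P.halfOpenCone ξ v ↔ (∀ w ∈ P.posEdges ξ v, 0 ≤ P.edgeCoord v w (x - v)) ∧
      ∀ w ∈ P.negEdges ξ v, P.edgeCoord v w (x - v) < 0 := by
  have hsum : ∀ c : EuclideanSpace ℝ (Fin d) → ℝ,
      ∑ w ∈ P.posEdges ξ v, c w • w + ∑ w ∈ P.negEdges ξ v, c w • w =
        ∑ w ∈ P.edgeDirections v, c w • w := by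
    intro c
    rw [← Finset.sum_filter_add_sum_filter_not (P.edgeDirections v) (fun w => 0 < ⟪w, ξ⟫), posEdges,
      negEdges]
    congr 2
    refine Finset.filter_congr fun w hw => ?_
    rw [not_lt]
    exact ⟨le_of_lt, fun h => h.lt_of_ne (hξ w hw)⟩
  constructor
  · rintro ⟨c, hc, hc', rfl⟩
    have h : ∀ w ∈ P.edgeDirections v, P.edgeCoord v w (v + ∑ w ∈ P.posEdges ξ v, c w • w +
        ∑ w ∈ P.negEdges ξ v, c w • w - v) = c w := fun w hw => by
      rw [add_assoc, hsum, add_sub_cancel_left, edgeCoord_sum hP hv hw]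
    refine ⟨fun w hw => ?_, fun w hw => ?_⟩
    · rw [h w (Finset.mem_of_mem_filter w hw)]
      exact hc w hw
    · rw [h w (Finset.mem_of_mem_filter w hw)]
      exact hc' w hw
  · rintro ⟨h, h'⟩
    refine ⟨fun w => P.edgeCoord v w (x - v), h, h', ?_⟩
    rw [add_assoc, hsum, sum_edgeCoord_smul hP hv]
    abel

theorem vertexTerm_eq_indicator_halfOpenCone (hP : P.IsSimple) {v ξ : EuclideanSpace ℝ (Fin d)}
    (hv : v ∈ P.vertices) (hξ : ∀ w ∈ P.edgeDirections v, ⟪w, ξ⟫ ≠ 0)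
    (x : EuclideanSpace ℝ (Fin d)) :
    P.vertexTerm v {w | ⟪w, ξ⟫ < 0} x =
      (-1) ^ (P.negEdges ξ v).card * if x ∈ P.halfOpenCone ξ v then 1 else 0 := by
  simp only [mem_halfOpenCone_iff hP hv hξ]
  rw [vertexTerm, ← Finset.prod_filter_mul_prod_filter_not (P.edgeDirections v)
    (fun w => ⟪w, ξ⟫ < 0)]
  have hone : ∀ (s : Finset (EuclideanSpace ℝ (Fin d))) (p : EuclideanSpace ℝ (Fin d) → Prop),
      (if ∀ w ∈ s, p w then (1 : ℂ) else 0) = ∏ w ∈ s, if p w then 1 else 0 := fun s p => by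
    rw [Finset.prod_ite_zero, Finset.prod_const_one]
  have hneg : ∏ w ∈ P.edgeDirections v with ⟪w, ξ⟫ < 0,
      ((if 0 ≤ P.edgeCoord v w (x - v) then (1 : ℂ) else 0) -
        (if w ∈ {w | ⟪w, ξ⟫ < 0} then 1 else 0)) = (-1) ^ (P.negEdges ξ v).card *
        if ∀ w ∈ P.negEdges ξ v, P.edgeCoord v w (x - v) < 0 then 1 else 0 := by
    rw [hone, ← Finset.prod_const, ← Finset.prod_mul_distrib]
    refine Finset.prod_congr rfl fun w hw => ?_
    have h : w ∈ {w | ⟪w, ξ⟫ < 0} := (Finset.mem_filter.1 hw).2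
    rw [if_pos h]
    by_cases hc : 0 ≤ P.edgeCoord v w (x - v)
    · rw [if_pos hc, if_neg hc.not_gt]
      simp
    · rw [if_neg hc, if_pos (not_le.1 hc)]
      simp
  have hpos : ∏ w ∈ P.edgeDirections v with ¬ ⟪w, ξ⟫ < 0,
      ((if 0 ≤ P.edgeCoord v w (x - v) then (1 : ℂ) else 0) -
        (if w ∈ {w | ⟪w, ξ⟫ < 0} then 1 else 0)) =
        if ∀ w ∈ P.posEdges ξ v, 0 ≤ P.edgeCoord v w (x - v) then 1 else 0 := by
    have hfilter : (P.edgeDirections v).filter (fun w => ¬ ⟪w, ξ⟫ < 0) = P.posEdges ξ v :=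
      Finset.filter_congr fun w hw =>
        ⟨fun h => (not_lt.1 h).lt_of_ne' (hξ w hw), fun h => h.le.not_gt⟩
    rw [hfilter, hone]
    refine Finset.prod_congr rfl fun w hw => ?_
    have h : ¬ w ∈ {w | ⟪w, ξ⟫ < 0} := (Finset.mem_filter.1 hw).2.le.not_gt
    rw [if_neg h, sub_zero]
  rw [hneg, hpos, mul_assoc, ite_zero_mul_ite_zero, one_mul]
  exact congrArg _ (if_congr and_comm rfl rfl)

/-! ### Crossing a wall -/

/-- The vectors on which `ξ + ε η` is negative for all small `ε > 0`. -/
def lexNeg (ξ η : EuclideanSpace ℝ (Fin d)) : Set (EuclideanSpace ℝ (Fin d)) :=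
  {w | ⟪w, ξ⟫ < 0 ∨ ⟪w, ξ⟫ = 0 ∧ ⟪w, η⟫ < 0}

theorem mem_lexNeg_of_ne {ξ η w : EuclideanSpace ℝ (Fin d)} (h : ⟪w, ξ⟫ ≠ 0) :
    w ∈ lexNeg ξ η ↔ ⟪w, ξ⟫ < 0 := by
  simp [lexNeg, h]

theorem mem_lexNeg_of_eq {ξ η w : EuclideanSpace ℝ (Fin d)} (h : ⟪w, ξ⟫ = 0) :
    w ∈ lexNeg ξ η ↔ ⟪w, η⟫ < 0 := by
  simp [lexNeg, h]

/-- The two vertices of an edge orthogonal to `ξ` contribute opposite jumps. -/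
theorem vertexTerm_jump_add (hP : P.IsSimple) {ξ η x v w₀ : EuclideanSpace ℝ (Fin d)}
    (hv : v ∈ P.vertices) (hw₀ : w₀ ∈ P.edgeDirections v) (h₀ : ⟪w₀, ξ⟫ = 0)
    (hξv : ∀ w ∈ P.edgeDirections v, w ≠ w₀ → ⟪w, ξ⟫ ≠ 0)
    (hξu : ∀ w ∈ P.edgeDirections (v + w₀), w ≠ -w₀ → ⟪w, ξ⟫ ≠ 0) :
    (P.vertexTerm v (lexNeg ξ η) x - P.vertexTerm v (lexNeg ξ (-η)) x) +
      (P.vertexTerm (v + w₀) (lexNeg ξ η) x - P.vertexTerm (v + w₀) (lexNeg ξ (-η)) x) = 0 := by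
  have hn : -w₀ ∈ P.edgeDirections (v + w₀) := neg_mem_edgeDirections hw₀
  have h₀' : ⟪-w₀, ξ⟫ = 0 := by rw [inner_neg_left, h₀, neg_zero]
  have hswap : ∀ {u w' : EuclideanSpace ℝ (Fin d)},
      (∀ w ∈ P.edgeDirections u, w ≠ w' → ⟪w, ξ⟫ ≠ 0) →
      ∏ w ∈ (P.edgeDirections u).erase w', ((if 0 ≤ P.edgeCoord u w (x - u) then (1 : ℂ) else 0) -
        (if w ∈ lexNeg ξ (-η) then 1 else 0)) = ∏ w ∈ (P.edgeDirections u).erase w',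
        ((if 0 ≤ P.edgeCoord u w (x - u) then 1 else 0) - (if w ∈ lexNeg ξ η then 1 else 0)) := by
    intro u w' h
    refine Finset.prod_congr rfl fun w hw => ?_
    have := h w (Finset.mem_of_mem_erase hw) (Finset.ne_of_mem_erase hw)
    simp only [mem_lexNeg_of_ne this]
  have hprod := prod_erase_other_end hP hv hw₀
    (fun w => (if 0 ≤ P.edgeCoord v w (x - v) then (1 : ℂ) else 0) -
      (if w ∈ lexNeg ξ η then 1 else 0))
    (fun w => (if 0 ≤ P.edgeCoord (v + w₀) w (x - (v + w₀)) then (1 : ℂ) else 0) -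
      (if w ∈ lexNeg ξ η then 1 else 0)) (by
    rintro w hw hne y hy hne' ⟨q, r, hq, hyw, hc⟩
    have hin : ⟪y, ξ⟫ = q * ⟪w, ξ⟫ := by
      rw [hyw, inner_add_left, real_inner_smul_left, real_inner_smul_left, h₀, mul_zero, add_zero]
    have hneg : q * ⟪w, ξ⟫ < 0 ↔ ⟪w, ξ⟫ < 0 := by simp [mul_neg_iff, hq, hq.not_gt]
    simp only [hc x, mul_nonneg_iff_of_pos_left hq, mem_lexNeg_of_ne (hξv w hw hne),
      mem_lexNeg_of_ne (hξu y hy hne'), hin, hneg])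
  simp only [vertexTerm]
  rw [← Finset.mul_prod_erase _ _ hw₀, ← Finset.mul_prod_erase _ _ hw₀,
    ← Finset.mul_prod_erase _ _ hn, ← Finset.mul_prod_erase _ _ hn, hswap hξv, hswap hξu, ← hprod]
  simp only [mem_lexNeg_of_eq h₀, mem_lexNeg_of_eq h₀', inner_neg_left, inner_neg_right, neg_neg]
  ring

theorem sum_vertexTerm_wall (hP : P.IsSimple) {ξ η x : EuclideanSpace ℝ (Fin d)}
    (hξ : ∀ v ∈ P.vertices, ∀ w ∈ P.edgeDirections v, ∀ w' ∈ P.edgeDirections v, w ≠ w' →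
      ⟪w, ξ⟫ = 0 → ⟪w', ξ⟫ ≠ 0) :
    ∑ v ∈ P.vertices, P.vertexTerm v (lexNeg ξ η) x =
      ∑ v ∈ P.vertices, P.vertexTerm v (lexNeg ξ (-η)) x := by
  rw [← sub_eq_zero, ← Finset.sum_sub_distrib]
  -- a vertex is paired with the other end of the edge at it that is orthogonal to `ξ`
  let g : EuclideanSpace ℝ (Fin d) → EuclideanSpace ℝ (Fin d) := fun v =>
    if h : ∃ w ∈ P.edgeDirections v, ⟪w, ξ⟫ = 0 then v + h.choose else v
  have hg : ∀ v ∈ P.vertices, ∀ w ∈ P.edgeDirections v, ⟪w, ξ⟫ = 0 → g v = v + w := by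
    intro v hv w hw hw0
    have h : ∃ w ∈ P.edgeDirections v, ⟪w, ξ⟫ = 0 := ⟨w, hw, hw0⟩
    simp only [g, dif_pos h]
    by_contra hne
    exact hξ v hv _ h.choose_spec.1 w hw (fun h' => hne (by rw [h'])) h.choose_spec.2 hw0
  have hg' : ∀ v, (¬ ∃ w ∈ P.edgeDirections v, ⟪w, ξ⟫ = 0) → g v = v := fun v h => by
    simp only [g, dif_neg h]
  refine Finset.sum_involution (fun v _ => g v) (fun v hv => ?_) (fun v hv hne => ?_)
    (fun v hv => ?_) (fun v hv => ?_)
  · by_cases h : ∃ w ∈ P.edgeDirections v, ⟪w, ξ⟫ = 0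
    · obtain ⟨w, hw, hw0⟩ := h
      have hu : v + w ∈ P.vertices := (P.mem_edgeDirections.1 hw).2.1
      rw [hg v hv w hw hw0]
      exact vertexTerm_jump_add hP hv hw hw0
        (fun w' hw' hne => hξ v hv w hw w' hw' hne.symm hw0)
        (fun w' hw' hne => hξ _ hu (-w) (neg_mem_edgeDirections hw) w' hw' hne.symm
          (by rw [inner_neg_left, hw0, neg_zero]))
    · rw [hg' v h]
      push Not at h
      rw [vertexTerm_congr (N' := lexNeg ξ (-η)) (fun w hw =>
        (mem_lexNeg_of_ne (h w hw)).trans (mem_lexNeg_of_ne (h w hw)).symm), sub_self, add_zero]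
  · by_cases h : ∃ w ∈ P.edgeDirections v, ⟪w, ξ⟫ = 0
    · obtain ⟨w, hw, hw0⟩ := h
      rw [hg v hv w hw hw0]
      simpa using ne_zero_of_mem_edgeDirections hw
    · push Not at h
      refine absurd ?_ hne
      rw [vertexTerm_congr (N' := lexNeg ξ (-η)) (fun w hw =>
        (mem_lexNeg_of_ne (h w hw)).trans (mem_lexNeg_of_ne (h w hw)).symm), sub_self]
  · by_cases h : ∃ w ∈ P.edgeDirections v, ⟪w, ξ⟫ = 0
    · obtain ⟨w, hw, hw0⟩ := h
      rw [hg v hv w hw hw0]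
      exact (P.mem_edgeDirections.1 hw).2.1
    · rwa [hg' v h]
  · by_cases h : ∃ w ∈ P.edgeDirections v, ⟪w, ξ⟫ = 0
    · obtain ⟨w, hw, hw0⟩ := h
      have hu : v + w ∈ P.vertices := (P.mem_edgeDirections.1 hw).2.1
      simp only [hg v hv w hw hw0]
      rw [hg _ hu (-w) (neg_mem_edgeDirections hw) (by rw [inner_neg_left, hw0, neg_zero])]
      abel
    · simp only [hg' v h]

/-! ### The indicator function of a simple polytope -/

/-- Near `ξ` on the line with direction `η`, signs are those of `ξ + ε η` on one side and those
of `ξ - ε η` on the other. -/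
theorem eventually_mem_lexNeg_iff (ξ η w : EuclideanSpace ℝ (Fin d)) :
    ∀ᶠ s : ℝ in 𝓝 0, (0 < s → (w ∈ lexNeg (ξ + s • η) η ↔ w ∈ lexNeg ξ η)) ∧
      (s < 0 → (w ∈ lexNeg (ξ + s • η) η ↔ w ∈ lexNeg ξ (-η))) := by
  have hin : ∀ s : ℝ, ⟪w, ξ + s • η⟫ = ⟪w, ξ⟫ + s * ⟪w, η⟫ := fun s => by
    rw [inner_add_right, real_inner_smul_right]
  have hcont : Tendsto (fun s : ℝ => ⟪w, ξ + s • η⟫) (𝓝 0) (𝓝 ⟪w, ξ⟫) := by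
    have : Continuous (fun s : ℝ => ⟪w, ξ + s • η⟫) := by fun_prop
    simpa using this.tendsto 0
  rcases lt_trichotomy ⟪w, ξ⟫ 0 with h | h | h
  · filter_upwards [hcont.eventually_lt_const h] with s hs
    simp [mem_lexNeg_of_ne hs.ne, mem_lexNeg_of_ne h.ne, hs, h]
  · refine Eventually.of_forall fun s => ⟨fun hs => ?_, fun hs => ?_⟩
    · rw [mem_lexNeg_of_eq h]
      simp only [lexNeg, Set.mem_ofPred_eq, hin, h, zero_add, mul_neg_iff, hs, hs.not_gt,
        mul_eq_zero, hs.ne', false_or, true_and, false_and, or_false]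
      exact ⟨fun h' => h'.elim id And.right, Or.inl⟩
    · rw [mem_lexNeg_of_eq h, inner_neg_right, neg_lt_zero]
      simp only [lexNeg, Set.mem_ofPred_eq, hin, h, zero_add, mul_neg_iff, hs, hs.not_gt,
        mul_eq_zero, hs.ne, false_or, true_and, false_and]
      constructor
      · rintro (h' | ⟨h', h''⟩)
        · exact h'
        · exact absurd h' h''.ne
      · exact Or.inl
  · filter_upwards [hcont.eventually_const_lt h] with s hs
    simp [mem_lexNeg_of_ne hs.ne', mem_lexNeg_of_ne h.ne', hs.not_gt, h.not_gt]

/-- Along a line that meets the walls at each vertex one at a time, the signed sum of the half-open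
cones does not change. -/
theorem sum_vertexTerm_line (hP : P.IsSimple) {ξ η x : EuclideanSpace ℝ (Fin d)}
    (hξ : ∀ t : ℝ, ∀ v ∈ P.vertices, ∀ w ∈ P.edgeDirections v, ∀ w' ∈ P.edgeDirections v, w ≠ w' →
      ⟪w, ξ + t • η⟫ = 0 → ⟪w', ξ + t • η⟫ ≠ 0) :
    ∑ v ∈ P.vertices, P.vertexTerm v (lexNeg ξ η) x =
      ∑ v ∈ P.vertices, P.vertexTerm v (lexNeg (ξ + η) η) x := by
  have hloc : IsLocallyConstant
      fun t : ℝ => ∑ v ∈ P.vertices, P.vertexTerm v (lexNeg (ξ + t • η) η) x := by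
    rw [IsLocallyConstant.iff_eventually_eq]
    intro t
    have hev : ∀ᶠ s in 𝓝 (0 : ℝ), ∀ v ∈ P.vertices, ∀ w ∈ P.edgeDirections v,
        (0 < s → (w ∈ lexNeg (ξ + t • η + s • η) η ↔ w ∈ lexNeg (ξ + t • η) η)) ∧
          (s < 0 → (w ∈ lexNeg (ξ + t • η + s • η) η ↔ w ∈ lexNeg (ξ + t • η) (-η))) := by
      rw [Finset.eventually_all]
      intro v _
      rw [Finset.eventually_all]
      exact fun w _ => eventually_mem_lexNeg_iff _ _ _
    have htend : Tendsto (fun s : ℝ => s - t) (𝓝 t) (𝓝 0) := by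
      have : Continuous fun s : ℝ => s - t := by fun_prop
      simpa using this.tendsto t
    filter_upwards [htend.eventually hev] with s hs
    rw [show ξ + t • η + (s - t) • η = ξ + s • η by rw [sub_smul]; abel] at hs
    rcases lt_trichotomy s t with h | h | h
    · rw [sum_vertexTerm_wall hP (hξ t)]
      exact Finset.sum_congr rfl fun v hv =>
        vertexTerm_congr (fun w hw => (hs v hv w hw).2 (sub_neg.2 h)) x
    · rw [h]
    · exact Finset.sum_congr rfl fun v hv =>
        vertexTerm_congr (fun w hw => (hs v hv w hw).1 (sub_pos.2 h)) x
  have := hloc.apply_eq_of_isPreconnected isPreconnected_univ (Set.mem_univ (0 : ℝ))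
    (Set.mem_univ 1)
  simpa using this

/-- A polytope and a point outside it are strictly separated by all vectors of a nonempty open
set. -/
theorem exists_isOpen_separating {x : EuclideanSpace ℝ (Fin d)} (hx : x ∉ P.carrier) :
    ∃ U : Set (EuclideanSpace ℝ (Fin d)), IsOpen U ∧ U.Nonempty ∧
      ∀ ξ ∈ U, ∀ v ∈ P.vertices, ⟪x - v, ξ⟫ < 0 := by
  obtain ⟨f, s, h1, h2⟩ := geometric_hahn_banach_point_closed P.convex_carrier
    P.isCompact_carrier.isClosed hx
  refine ⟨⋂ v ∈ P.vertices, {ξ | ⟪x - v, ξ⟫ < 0}, ?_, ⟨(InnerProductSpace.toDual ℝ _).symm f, ?_⟩,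
    fun ξ hξ v hv => Set.mem_iInter₂.1 hξ v hv⟩
  · exact isOpen_biInter_finset fun v _ => isOpen_lt (by fun_prop) continuous_const
  · refine Set.mem_iInter₂.2 fun v hv => ?_
    have := h2 v (P.vertices_subset_carrier hv)
    rw [Set.mem_ofPred_eq, real_inner_comm, InnerProductSpace.toDual_symm_apply, map_sub]
    linarith

/-- Vectors not orthogonal to any of finitely many given nonzero vectors are dense. -/
theorem dense_forall_inner_ne_zero {S : Set (EuclideanSpace ℝ (Fin d))} (hS : S.Finite)
    (h0 : ∀ z ∈ S, z ≠ 0) : Dense {ξ : EuclideanSpace ℝ (Fin d) | ∀ z ∈ S, ⟪z, ξ⟫ ≠ 0} := by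
  have : {ξ : EuclideanSpace ℝ (Fin d) | ∀ z ∈ S, ⟪z, ξ⟫ ≠ 0} =
      ⋂ z ∈ S, {ξ | ⟪z, ξ⟫ ≠ 0} := by
    ext
    simp
  rw [this]
  refine dense_biInter_of_isOpen (fun z _ => isOpen_ne_fun (by fun_prop) continuous_const)
    hS.countable fun z hz => ?_
  have hker : {ξ : EuclideanSpace ℝ (Fin d) | ⟪z, ξ⟫ ≠ 0} = ((ℝ ∙ z)ᗮ : Set _)ᶜ := by
    ext ξ
    simp [Submodule.mem_orthogonal_singleton_iff_inner_right]
  rw [hker]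
  refine interior_eq_empty_iff_dense_compl.1 (Set.not_nonempty_iff_eq_empty.1 fun hint =>
    h0 z hz ?_)
  have htop := Submodule.eq_top_of_nonempty_interior' _ hint
  have : z ∈ (ℝ ∙ z)ᗮ := htop ▸ Submodule.mem_top
  rw [Submodule.mem_orthogonal_singleton_iff_inner_right] at this
  exact inner_self_eq_zero.1 this

theorem sum_vertexTerm_of_notMem (hP : P.IsSimple) {ξ x : EuclideanSpace ℝ (Fin d)}
    (hξ : ∀ v ∈ P.vertices, ∀ w ∈ P.edgeDirections v, ⟪w, ξ⟫ ≠ 0) (hx : x ∉ P.carrier) :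
    ∑ v ∈ P.vertices, P.vertexTerm v {w | ⟪w, ξ⟫ < 0} x = 0 := by
  obtain ⟨U, hU, hUne, hsep⟩ := exists_isOpen_separating hx
  -- the line through `ξ` and `ξ'` meets two walls of a vertex at the same point only if `ξ'` is
  -- orthogonal to one of the vectors of this set
  let S : Set (EuclideanSpace ℝ (Fin d)) := ⋃ v ∈ P.vertices, ⋃ w ∈ P.edgeDirections v,
    ⋃ w' ∈ (P.edgeDirections v).erase w, {⟪w', ξ⟫ • w - ⟪w, ξ⟫ • w'}
  have hS : S.Finite := P.vertices.finite_toSet.biUnion fun v _ =>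
    (P.edgeDirections v).finite_toSet.biUnion fun w _ =>
      ((P.edgeDirections v).erase w).finite_toSet.biUnion fun _ _ => Set.finite_singleton _
  have hmemS : ∀ v ∈ P.vertices, ∀ w ∈ P.edgeDirections v, ∀ w' ∈ P.edgeDirections v, w ≠ w' →
      ⟪w', ξ⟫ • w - ⟪w, ξ⟫ • w' ∈ S := fun v hv w hw w' hw' hne => by
    simp only [S, Set.mem_iUnion]
    exact ⟨v, hv, w, hw, w', Finset.mem_erase.2 ⟨hne.symm, hw'⟩, rfl⟩
  have hS0 : ∀ z ∈ S, z ≠ 0 := by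
    intro z hz
    simp only [S, Set.mem_iUnion] at hz
    obtain ⟨v, hv, w, hw, w', hw', rfl⟩ := hz
    rw [Finset.mem_erase] at hw'
    exact smul_sub_smul_ne_zero hP hv hw hw'.2 hw'.1.symm (hξ v hv w' hw'.2) _
  obtain ⟨ξ', hξ'U, hξ'⟩ := (dense_forall_inner_ne_zero hS hS0).inter_open_nonempty U hU hUne
  have hline := sum_vertexTerm_line (ξ := ξ') (η := ξ - ξ') (x := x) hP (by
    intro t v hv w hw w' hw' hne h h'
    have hz := hξ' _ (hmemS v hv w hw w' hw' hne)
    rw [show ξ' + t • (ξ - ξ') = (1 - t) • ξ' + t • ξ by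
      rw [smul_sub, sub_smul, one_smul]; abel] at h h'
    simp only [inner_add_right, real_inner_smul_right] at h h'
    simp only [inner_sub_left, real_inner_smul_left] at hz
    have ht : (1 - t) * (⟪w', ξ⟫ * ⟪w, ξ'⟫ - ⟪w, ξ⟫ * ⟪w', ξ'⟫) = 0 := by
      linear_combination ⟪w', ξ⟫ * h - ⟪w, ξ⟫ * h'
    rcases mul_eq_zero.1 ht with ht | ht
    · rw [ht, zero_mul, zero_add, sub_eq_zero.1 ht |>.symm, one_mul] at h
      exact hξ v hv w hw h
    · exact hz ht)
  rw [add_sub_cancel] at hline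
  have hcongr : ∑ v ∈ P.vertices, P.vertexTerm v (lexNeg ξ (ξ - ξ')) x =
      ∑ v ∈ P.vertices, P.vertexTerm v {w | ⟪w, ξ⟫ < 0} x :=
    Finset.sum_congr rfl fun v hv =>
      vertexTerm_congr (fun w hw => mem_lexNeg_of_ne (hξ v hv w hw)) x
  rw [← hcongr, ← hline]
  refine Finset.sum_eq_zero fun v hv => ?_
  by_contra hne
  rw [← ne_eq, vertexTerm, Finset.prod_ne_zero_iff] at hne
  -- `x` in the half-open cone at `v` would have `⟪x, ξ'⟫ ≥ ⟪v, ξ'⟫`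
  refine (hsep ξ' hξ'U v hv).not_ge ?_
  rw [← sum_edgeCoord_smul hP hv (x - v), sum_inner]
  refine Finset.sum_nonneg fun w hw => ?_
  rw [real_inner_smul_left]
  have h := hne w hw
  by_cases hc : 0 ≤ P.edgeCoord v w (x - v)
  · refine mul_nonneg hc (not_lt.1 fun hlt => h ?_)
    have hmem : w ∈ lexNeg ξ' (ξ - ξ') := Or.inl hlt
    rw [if_pos hc, if_pos hmem, sub_self]
  · refine mul_nonneg_of_nonpos_of_nonpos (not_le.1 hc).le (not_lt.1 fun hlt => h ?_)
    have : w ∉ lexNeg ξ' (ξ - ξ') := by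
      rw [mem_lexNeg_of_ne hlt.ne']
      exact hlt.not_gt
    rw [if_neg hc, if_neg this, sub_self]

theorem sum_vertexTerm_of_mem (hP : P.IsSimple) {ξ x : EuclideanSpace ℝ (Fin d)}
    (hξ : ∀ v ∈ P.vertices, ∀ w ∈ P.edgeDirections v, ⟪w, ξ⟫ ≠ 0) (hx : x ∈ P.carrier) :
    ∑ v ∈ P.vertices, P.vertexTerm v {w | ⟪w, ξ⟫ < 0} x = 1 := by
  have hne : P.vertices.Nonempty := by
    rw [Finset.nonempty_iff_ne_empty]
    intro h
    rw [← P.convexHull_vertices, h] at hx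
    simp at hx
  -- only the vertex `v₀` at which `ξ` is minimal contributes
  obtain ⟨v₀, hv₀, hmin⟩ := P.vertices.exists_min_image (fun v => ⟪v, ξ⟫) hne
  have hval : ∀ v ∈ P.vertices, P.vertexTerm v {w | ⟪w, ξ⟫ < 0} x =
      ∏ w ∈ P.edgeDirections v, (1 - if ⟪w, ξ⟫ < 0 then (1 : ℂ) else 0) := fun v hv =>
    Finset.prod_congr rfl fun w hw => by
      rw [if_pos (edgeCoord_sub_nonneg hP hv hw hx)]
      rfl
  rw [Finset.sum_eq_single_of_mem v₀ hv₀]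
  · rw [hval v₀ hv₀]
    refine Finset.prod_eq_one fun w hw => ?_
    have := hmin (v₀ + w) (P.mem_edgeDirections.1 hw).2.1
    rw [inner_add_left] at this
    rw [if_neg (by linarith), sub_zero]
  · intro v hv hne
    rw [hval v hv]
    by_contra h
    rw [← ne_eq, Finset.prod_ne_zero_iff] at h
    have hpos : ∀ w ∈ P.edgeDirections v, 0 < ⟪w, ξ⟫ := fun w hw =>
      (not_lt.1 fun hlt => h w hw (by simp [hlt])).lt_of_ne' (hξ v hv w hw)
    have hterm : ∀ w ∈ P.edgeDirections v, 0 ≤ P.edgeCoord v w (v₀ - v) * ⟪w, ξ⟫ := fun w hw =>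
      mul_nonneg (edgeCoord_sub_nonneg hP hv hw (P.vertices_subset_carrier hv₀)) (hpos w hw).le
    have hsum : ⟪v₀ - v, ξ⟫ = ∑ w ∈ P.edgeDirections v, P.edgeCoord v w (v₀ - v) * ⟪w, ξ⟫ := by
      conv_lhs => rw [← sum_edgeCoord_smul hP hv (v₀ - v)]
      simp only [sum_inner, real_inner_smul_left]
    have h0 : ∑ w ∈ P.edgeDirections v, P.edgeCoord v w (v₀ - v) * ⟪w, ξ⟫ = 0 := by
      refine le_antisymm ?_ (Finset.sum_nonneg hterm)
      rw [← hsum, inner_sub_left]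
      linarith [hmin v hv]
    rw [Finset.sum_eq_zero_iff_of_nonneg hterm] at h0
    refine hne (sub_eq_zero.1 ?_).symm
    rw [← sum_edgeCoord_smul hP hv (v₀ - v)]
    exact Finset.sum_eq_zero fun w hw => by
      rw [(mul_eq_zero.1 (h0 w hw)).resolve_right (hpos w hw).ne', zero_smul]

end Polytope

/-! ### Formal series representing rational functions -/

section Series

variable {d : ℕ}

theorem polyMul_add (g : LaurentPoly d) (S T : FormalSeries d) :
    polyMul g (fun m => S m + T m) = fun m => polyMul g S m + polyMul g T m := by
  simp only [polyMul_eq_lift]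
  exact map_add _ S T

theorem polyMul_neg (g : LaurentPoly d) (S : FormalSeries d) :
    polyMul g (fun m => -S m) = fun m => -polyMul g S m := by
  simp only [polyMul_eq_lift]
  exact map_neg _ S

theorem polyMul_one_sub_single (z : Fin d → ℤ) (S : FormalSeries d) :
    polyMul (1 - AddMonoidAlgebra.single z 1) S = fun m => S m - S (m - z) := by
  rw [polyMul_eq_lift, map_sub, map_one, AddMonoidAlgebra.lift_single]
  funext m
  simp [shift]

/-- The factor `1 - x ^ z i` acts on the factor `φ i` only, as a difference operator. -/
theorem polyMul_prod_one_sub_single {ι : Type*} (s : Finset ι) (z : ι → Fin d → ℤ)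
    (φ : ι → FormalSeries d) (hφ : ∀ i ∈ s, ∀ j ∈ s, i ≠ j → ∀ m, φ i (m - z j) = φ i m)
    (ψ : FormalSeries d) (hψ : ∀ i ∈ s, ∀ m, ψ (m - z i) = ψ m) :
    polyMul (∏ i ∈ s, (1 - AddMonoidAlgebra.single (z i) 1)) (fun m => ψ m * ∏ i ∈ s, φ i m) =
      fun m => ψ m * ∏ i ∈ s, (φ i m - φ i (m - z i)) := by
  induction s using Finset.induction_on generalizing ψ with
  | empty =>
    rw [Finset.prod_empty, polyMul_eq_lift, map_one]
    rfl
  | insert a s ha ih =>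
    have hne : ∀ i ∈ s, i ≠ a := fun i hi h => ha (h ▸ hi)
    have h := ih (fun i hi j hj => hφ i (Finset.mem_insert_of_mem hi) j (Finset.mem_insert_of_mem hj))
      (fun m => ψ m * φ a m) (fun i hi m => by
        rw [hψ i (Finset.mem_insert_of_mem hi), hφ a (Finset.mem_insert_self a s) i
          (Finset.mem_insert_of_mem hi) (hne i hi).symm])
    simp only [Finset.prod_insert ha, ← mul_assoc]
    rw [polyMul_mul, h, polyMul_one_sub_single]
    funext m
    have hprod : ∏ i ∈ s, (φ i (m - z a) - φ i (m - z a - z i)) =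
        ∏ i ∈ s, (φ i m - φ i (m - z i)) := Finset.prod_congr rfl fun i hi => by
      have hi' := hφ i (Finset.mem_insert_of_mem hi) a (Finset.mem_insert_self a s) (hne i hi)
      rw [sub_right_comm, hi', hi']
    rw [hprod, hψ a (Finset.mem_insert_self a s)]
    ring

theorem Represents.zero : Represents (fun _ : Fin d → ℤ => 0) 0 :=
  ⟨1, 0, one_ne_zero, by
    rw [polyMul_eq_lift, map_one]
    rfl, by simp⟩

theorem Represents.add {S T : FormalSeries d} {f g : RationalFunction d} (hS : Represents S f)
    (hT : Represents T g) : Represents (fun m => S m + T m) (f + g) := by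
  obtain ⟨p, h, hp, hS, rfl⟩ := hS
  obtain ⟨q, k, hq, hT, rfl⟩ := hT
  refine ⟨p * q, h * q + p * k, mul_ne_zero hp hq, ?_, ?_⟩
  · have h1 : polyMul (p * q) S = fun m => (h * q).coeff m := by
      rw [mul_comm p q, polyMul_mul, hS, polyMul_coeff, mul_comm]
    have h2 : polyMul (p * q) T = fun m => (p * k).coeff m := by
      rw [polyMul_mul, hT, polyMul_coeff]
    rw [polyMul_add, h1, h2]
    rfl
  · rw [div_add_div _ _ (by simpa using hp) (by simpa using hq)]
    simp only [map_mul, map_add]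

theorem Represents.neg {S : FormalSeries d} {f : RationalFunction d} (hS : Represents S f) :
    Represents (fun m => -S m) (-f) := by
  obtain ⟨p, h, hp, hS, rfl⟩ := hS
  refine ⟨p, -h, hp, ?_, ?_⟩
  · rw [polyMul_neg, hS]
    rfl
  · rw [map_neg]
    exact (neg_div _ _).symm

theorem Represents.neg_one_pow_mul {S : FormalSeries d} {f : RationalFunction d}
    (hS : Represents S f) (k : ℕ) : Represents (fun m => (-1) ^ k * S m) ((-1) ^ k * f) := by
  rcases neg_one_pow_eq_or ℂ k with h | h <;> rcases Nat.even_or_odd k with hk | hk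
  all_goals simp only [hk.neg_one_pow, one_mul, neg_mul]
  exacts [hS, hS.neg, hS, hS.neg]

theorem Represents.sum {ι : Type*} (s : Finset ι) {S : ι → FormalSeries d}
    {f : ι → RationalFunction d} (h : ∀ i ∈ s, Represents (S i) (f i)) :
    Represents (fun m => ∑ i ∈ s, S i m) (∑ i ∈ s, f i) := by
  induction s using Finset.induction_on with
  | empty => simpa using Represents.zero
  | insert a s ha ih =>
    simp only [Finset.sum_insert ha]
    exact (h a (Finset.mem_insert_self a s)).add
      (ih fun i hi => h i (Finset.mem_insert_of_mem hi))

theorem latticePoint_sub (m z : Fin d → ℤ) :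
    latticePoint (m - z) = latticePoint m - latticePoint z := by
  ext i
  simp [latticePoint]

theorem finite_latticePoint_mem {A : Set (EuclideanSpace ℝ (Fin d))}
    (hA : Bornology.IsBounded A) : {m : Fin d → ℤ | latticePoint m ∈ A}.Finite := by
  obtain ⟨R, hR⟩ := hA.exists_norm_le
  refine (Set.finite_Icc (fun _ : Fin d => -⌈R⌉) (fun _ => ⌈R⌉)).subset fun m hm => ?_
  have h : ∀ i, |(m i : ℝ)| ≤ ⌈R⌉ := fun i =>
    ((PiLp.norm_apply_le (latticePoint m) i).trans (hR _ hm)).trans (Int.le_ceil R)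
  refine ⟨fun i => ?_, fun i => ?_⟩
  · exact_mod_cast (abs_le.1 (h i)).1
  · exact_mod_cast (abs_le.1 (h i)).2

end Series

namespace Polytope

variable {d : ℕ} {P : Polytope d}

theorem exists_latticePoint_eq_smul (hrat : P.HasRationalEdges) {v w : EuclideanSpace ℝ (Fin d)}
    (hv : v ∈ P.vertices) (hw : w ∈ P.edgeDirections v) :
    ∃ (z : Fin d → ℤ) (t : ℝ), 0 < t ∧ latticePoint z = t • w := by
  obtain ⟨z, c, hz⟩ := hrat v hv w hw
  have hwc : w = c • latticePoint z := by
    ext i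
    simp [latticePoint, hz i]
  have hc : c ≠ 0 := by
    rintro rfl
    exact ne_zero_of_mem_edgeDirections hw (by simpa using hwc)
  rcases hc.lt_or_gt with hc' | hc'
  · refine ⟨-z, -c⁻¹, neg_pos.2 (inv_lt_zero.2 hc'), ?_⟩
    rw [hwc, neg_smul, inv_smul_smul₀ hc, ← zero_sub, latticePoint_sub, ← zero_sub]
    congr 1
    ext i
    simp [latticePoint]
  · exact ⟨z, c⁻¹, inv_pos.2 hc', by rw [hwc, inv_smul_smul₀ hc]⟩

/-- The rational function of a signed half-open cone at a vertex does not depend on the set of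
reversed edges: multiplication by `1 - x ^ z`, with `z` along an edge, kills the difference of the
signed indicator functions, which is constant in the direction of this edge. -/
theorem exists_forall_represents_vertexTerm (hP : P.IsSimple) (hrat : P.HasRationalEdges)
    {v : EuclideanSpace ℝ (Fin d)} (hv : v ∈ P.vertices) :
    ∃ f : RationalFunction d, ∀ N : Set (EuclideanSpace ℝ (Fin d)),
      Represents (fun m => P.vertexTerm v N (latticePoint m)) f := by
  choose! z t ht hz using fun w (hw : w ∈ P.edgeDirections v) =>
    exists_latticePoint_eq_smul hrat hv hw
  let a : EuclideanSpace ℝ (Fin d) → FormalSeries d := fun w m =>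
    if 0 ≤ P.edgeCoord v w (latticePoint m - v) then 1 else 0
  have hshift : ∀ w w' m, P.edgeCoord v w (latticePoint (m - z w') - v) =
      P.edgeCoord v w (latticePoint m - v) - P.edgeCoord v w (latticePoint (z w')) := by
    intro w w' m
    rw [latticePoint_sub, ← map_sub, sub_right_comm]
  have hself : ∀ w ∈ P.edgeDirections v, P.edgeCoord v w (latticePoint (z w)) = t w := by
    intro w hw
    rw [hz w hw, map_smul, edgeCoord_self hP hv hw, smul_eq_mul, mul_one]
  have hother : ∀ w ∈ P.edgeDirections v, ∀ w' ∈ P.edgeDirections v, w ≠ w' →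
      P.edgeCoord v w (latticePoint (z w')) = 0 := by
    intro w hw w' hw' hne
    rw [hz w' hw', map_smul, edgeCoord_of_ne hP hv hw hw' hne, smul_zero]
  let F : FormalSeries d := fun m => ∏ w ∈ P.edgeDirections v, (a w m - a w (m - z w))
  -- the support of `F` consists of the integer points of a half-open parallelepiped
  have hF : (Function.support F).Finite := by
    have hbdd : Bornology.IsBounded {x : EuclideanSpace ℝ (Fin d) |
        ∀ w ∈ P.edgeDirections v, |P.edgeCoord v w (x - v)| ≤ t w} := by
      refine isBounded_iff_forall_norm_le.2
        ⟨‖v‖ + ∑ w ∈ P.edgeDirections v, t w * ‖w‖, fun x hx => ?_⟩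
      calc ‖x‖ = ‖v + ∑ w ∈ P.edgeDirections v, P.edgeCoord v w (x - v) • w‖ := by
            rw [sum_edgeCoord_smul hP hv, add_sub_cancel]
        _ ≤ ‖v‖ + ∑ w ∈ P.edgeDirections v, ‖P.edgeCoord v w (x - v) • w‖ :=
            (norm_add_le _ _).trans (by gcongr; exact norm_sum_le _ _)
        _ ≤ _ := by
            gcongr with w hw
            rw [norm_smul, Real.norm_eq_abs]
            gcongr
            exact hx w hw
    refine (finite_latticePoint_mem hbdd).subset fun m hm w hw => ?_
    have hne := Finset.prod_ne_zero_iff.1 hm w hw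
    simp only [a, hshift, hself w hw] at hne
    have htw := ht w hw
    by_cases h1 : 0 ≤ P.edgeCoord v w (latticePoint m - v)
    · by_cases h2 : 0 ≤ P.edgeCoord v w (latticePoint m - v) - t w
      · rw [if_pos h1, if_pos h2, sub_self] at hne
        exact absurd rfl hne
      · rw [abs_of_nonneg h1]
        linarith
    · rw [if_neg h1, if_neg (by linarith), sub_self] at hne
      exact absurd rfl hne
  have hz0 : ∀ w ∈ P.edgeDirections v, z w ≠ 0 := by
    intro w hw h
    have h1 := hself w hw
    rw [h, show latticePoint (0 : Fin d → ℤ) = 0 by ext i; simp [latticePoint], map_zero] at h1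
    exact (ht w hw).ne h1
  let h : LaurentPoly d := AddMonoidAlgebra.ofCoeff (Finsupp.ofSupportFinite F hF)
  refine ⟨algebraMap _ _ h / algebraMap _ _
    (∏ w ∈ P.edgeDirections v, (1 - AddMonoidAlgebra.single (z w) 1)), fun N =>
    ⟨∏ w ∈ P.edgeDirections v, (1 - AddMonoidAlgebra.single (z w) 1), h, ?_, ?_, rfl⟩⟩
  · refine Finset.prod_ne_zero_iff.2 fun w hw h0 => hz0 w hw ?_
    rw [sub_eq_zero, AddMonoidAlgebra.one_def] at h0
    by_contra hne
    have := congrArg (fun p : LaurentPoly d => p.coeff (z w)) h0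
    simp [Ne.symm hne] at this
  · have := polyMul_prod_one_sub_single (P.edgeDirections v) z
      (fun w m => a w m - if w ∈ N then 1 else 0) (fun w hw w' hw' hne m => by
        simp only [a, hshift, hother w hw w' hw' hne, sub_zero]) (fun _ => 1) (fun _ _ _ => rfl)
    simp only [one_mul, sub_sub_sub_cancel_right] at this
    exact this

end Polytope

end LawrenceVarchenko

end

theorem mainTheorem2 {d : ℕ} (P : LawrenceVarchenko.Polytope d)
    (hsimple : P.IsSimple) (hrational : P.HasRationalEdges)
    (ξ : EuclideanSpace ℝ (Fin d) → EuclideanSpace ℝ (Fin d))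
    (hξ : ∀ v ∈ P.vertices, ∀ w ∈ P.edgeDirections v, inner ℝ w (ξ v) ≠ 0) :
    {m : Fin d → ℤ | LawrenceVarchenko.latticePoint m ∈ P.carrier}.Finite ∧
    (∀ v ∈ P.vertices, ∃ f : LawrenceVarchenko.RationalFunction d,
      LawrenceVarchenko.Represents
        (LawrenceVarchenko.latticeSeries (P.halfOpenCone (ξ v) v)) f) ∧
    LawrenceVarchenko.sigma P.carrier =
      ∑ v ∈ P.vertices, (-1) ^ (P.negEdges (ξ v) v).card *
        LawrenceVarchenko.sigma (P.halfOpenCone (ξ v) v) := by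
  open LawrenceVarchenko Polytope in
  choose! f hf using fun v (hv : v ∈ P.vertices) =>
    exists_forall_represents_vertexTerm hsimple hrational hv
  have hcone : ∀ v ∈ P.vertices, Represents (latticeSeries (P.halfOpenCone (ξ v) v))
      ((-1) ^ (P.negEdges (ξ v) v).card * f v) := by
    intro v hv
    have h := (hf v hv {w | inner ℝ w (ξ v) < 0}).neg_one_pow_mul (P.negEdges (ξ v) v).card
    simp only [vertexTerm_eq_indicator_halfOpenCone hsimple hv (hξ v hv), ← mul_assoc,
      ← mul_pow, neg_one_mul, neg_neg, one_pow, one_mul] at h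
    exact h
  refine ⟨finite_latticePoint_mem P.isCompact_carrier.isBounded,
    fun v hv => ⟨_, hcone v hv⟩, ?_⟩
  -- a single vector for all vertices, for which the indicator functions add up
  obtain ⟨ξ₀, hξ₀⟩ := (dense_forall_inner_ne_zero
    (S := ⋃ v ∈ P.vertices, (P.edgeDirections v : Set (EuclideanSpace ℝ (Fin d))))
    (P.vertices.finite_toSet.biUnion fun v _ => (P.edgeDirections v).finite_toSet)
    (fun w hw => by
      simp only [Set.mem_iUnion] at hw
      obtain ⟨v, -, hw⟩ := hw
      exact ne_zero_of_mem_edgeDirections hw)).nonempty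
  have hξ₀' : ∀ v ∈ P.vertices, ∀ w ∈ P.edgeDirections v, inner ℝ w ξ₀ ≠ 0 := fun v hv w hw =>
    hξ₀ w (by simp only [Set.mem_iUnion]; exact ⟨v, hv, hw⟩)
  have hsum : Represents (latticeSeries P.carrier) (∑ v ∈ P.vertices, f v) := by
    convert Represents.sum P.vertices fun v hv => hf v hv {w | inner ℝ w ξ₀ < 0} using 1
    funext m
    rw [latticeSeries]
    split_ifs with hm
    · exact (sum_vertexTerm_of_mem hsimple hξ₀' hm).symm
    · exact (sum_vertexTerm_of_notMem hsimple hξ₀' hm).symm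
  rw [hsum.sigma_eq]
  refine Finset.sum_congr rfl fun v hv => ?_
  rw [(hcone v hv).sigma_eq, ← mul_assoc, ← mul_pow, neg_one_mul, neg_neg, one_pow, one_mul]
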